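/- There is a nonempty open subset $U\subset(\mathbb P^2(\mathbb C))^4$ (for the classical topology) such that for every $(p_1,\dots,p_4)\in U$ the 8 points $p_1,\bar p_1,\dots,p_4,\bar p_4$ are pairwise distinct and no degree 3 rational curve defined over $\mathbb R$ passes through all 8 of them. (A degree 3 rational curve defined over $\mathbb R$ is a curve $(F=0)\subset\mathbb P^2$, with $F\in\mathbb R[x,y,z]$ a cubic form, which over $\mathbb C$ is irreducible and birational to $\mathbb P^1$. Since $U$ is open and nonempty, it contains generic configurations: it is not contained in any proper real algebraic subset of the space of configurations.) Moreover, $U$ can be chosen to contain every $(p_1,\dots,p_4)$ such that $p_1,\dots,p_4$ lie on the empty conic $x^2+y^2+z^2=0$ and $p_1,\bar p_1,\dots,p_4,\bar p_4$ are pairwise distinct. -/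

import Mathlib

open MvPolynomial

noncomputable section

/-- The complex projective plane, as the set of lines through the origin in `ℂ³`. -/
abbrev CP2 : Type := Projectivization ℂ (Fin 3 → ℂ)

/-- The classical topology of `ℙ²(ℂ)`: the quotient topology from `ℂ³ \ {0}`. -/
instance CP2.instTopologicalSpace : TopologicalSpace CP2 :=
  TopologicalSpace.coinduced (Projectivization.mk' ℂ (V := Fin 3 → ℂ)) inferInstance

/-- Complex conjugation of the points of `ℙ²(ℂ)`, i.e. `[x:y:z] ↦ [x̄:ȳ:z̄]`. -/
def CP2.conj : CP2 → CP2 :=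
  Projectivization.map
    ((starLinearEquiv ℂ : (Fin 3 → ℂ) ≃ₗ⋆[ℂ] (Fin 3 → ℂ)) : (Fin 3 → ℂ) →ₗ⋆[ℂ] (Fin 3 → ℂ))
    (starLinearEquiv ℂ : (Fin 3 → ℂ) ≃ₗ⋆[ℂ] (Fin 3 → ℂ)).injective

/-- The form `F` vanishes at the point `P`. This is only used for homogeneous `F`, where it does
not depend on the representative of `P`. -/
def VanishesAt (F : MvPolynomial (Fin 3) ℂ) (P : CP2) : Prop :=
  eval P.rep F = 0

/-- The plane curve `(F = 0)` over `ℂ`, with `F` a form, is a rational curve of degree `d`: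
it is an irreducible curve of degree `d` which is birational to `ℙ¹`.
The rational map `ℙ¹ ⇢ (F = 0)` is given by three binary forms `g 0, g 1, g 2` of the same degree,
its rational inverse `(F = 0) ⇢ ℙ¹` by two ternary forms `h 0, h 1` of the same degree; that
the composite `ℙ¹ ⇢ ℙ¹` is the identity means `(h 0 ∘ g, h 1 ∘ g) = c · (s, t)` with `c ≠ 0`.
(Then the other composite is the identity as well, since `(F = 0)` is irreducible.) -/
def IsRationalPlaneCurve (d : ℕ) (F : MvPolynomial (Fin 3) ℂ) : Prop :=
  F.IsHomogeneous d ∧ Irreducible F ∧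
    ∃ (m n : ℕ) (g : Fin 3 → MvPolynomial (Fin 2) ℂ) (h : Fin 2 → MvPolynomial (Fin 3) ℂ)
      (c : MvPolynomial (Fin 2) ℂ),
      (∀ i, (g i).IsHomogeneous m) ∧ (∀ j, (h j).IsHomogeneous n) ∧ c ≠ 0 ∧
        aeval g F = 0 ∧ ∀ j, aeval g (h j) = c * X j

/-- The complexification of a polynomial with real coefficients. -/
def complexify (F : MvPolynomial (Fin 3) ℝ) : MvPolynomial (Fin 3) ℂ :=
  map (algebraMap ℝ ℂ) F

/-- The equation `x² + y² + z²` of the empty conic. -/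
def emptyConic : MvPolynomial (Fin 3) ℝ :=
  X 0 ^ 2 + X 1 ^ 2 + X 2 ^ 2

/-- The `8` points `p₁, p̄₁, …, p₄, p̄₄` are pairwise distinct. -/
def EightDistinctPoints (p : Fin 4 → CP2) : Prop :=
  Function.Injective (Sum.elim p fun i => (p i).conj)

end

/-!
A rational plane cubic over `ℂ` is singular, and being irreducible it has only one singular point:
the line through two of them would meet the cubic with multiplicity at least four, and so be a
component of it. If the cubic is defined over `ℝ`, complex conjugation fixes this point, so every
real rational cubic has a real singular point (`IsRationalPlaneCurve.exists_real_isSingularAt`).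
It is therefore enough to consider the set `goodConfigurations` of the configurations of eight
distinct points through which there passes no real cubic form `F ≠ 0` with a real singular point.

* This set is open (`isOpen_goodConfigurations`): the pairs consisting of a real cubic form and of a
  real point, both taken up to scaling, vary in a compact space, and the conditions on a
  configuration to lie on the cubic, and on the cubic to be singular at the point, are closed.
* It contains the configurations on the empty conic (`mem_goodConfigurations_of_conic`). A real
  cubic through eight points of the conic contains the conic (`eval_eq_zero_of_conic`), so it is the
  union of the conic and a real line, which is smooth at all its real points
  (`eq_zero_of_conic_of_isSingularAt`).

That a rational cubic is singular (`IsRationalPlaneCurve.exists_isSingularAt`) is the fact that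
`ℙ¹` has no holomorphic differentials, in the following elementary form. Let `g` be a vector of
polynomials of degree `m` without common zeros, parametrizing part of the curve `F = 0`. Both `g`
and `g'` are orthogonal to the vector `N` of the partial derivatives of `F` along `g`. If `F = 0` is
smooth, then `N` has no zeros, so the cross product `g × g'` is a polynomial multiple of `N`. But
`N` has degree `2 * m`, because `F = 0` is smooth also at the point at infinity of the curve, and
`g × g'` has smaller degree. Hence `g × g' = 0` and `g` is constant.
-/

/-! ### Forms along polynomial curves -/

namespace MvPolynomial

variable {σ R : Type*} [CommRing R]

lemma natDegree_prod_pow_le {ι : Type*} (s : Finset ι) (g : ι → Polynomial R) {m : ℕ}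
    (hg : ∀ i, (g i).natDegree ≤ m) (e : ι → ℕ) :
    (∏ i ∈ s, g i ^ e i).natDegree ≤ (∑ i ∈ s, e i) * m := by
  rw [Finset.sum_mul]
  refine (Polynomial.natDegree_prod_le _ _).trans (Finset.sum_le_sum fun i _ => ?_)
  exact Polynomial.natDegree_pow_le_of_le _ (hg i)

lemma coeff_prod_pow_of_natDegree_le {ι : Type*} (s : Finset ι) (g : ι → Polynomial R) {m : ℕ}
    (hg : ∀ i, (g i).natDegree ≤ m) (e : ι → ℕ) :
    (∏ i ∈ s, g i ^ e i).coeff ((∑ i ∈ s, e i) * m) = ∏ i ∈ s, (g i).coeff m ^ e i := by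
  classical
  induction s using Finset.induction_on with
  | empty => simp
  | insert a s ha ih =>
    rw [Finset.prod_insert ha, Finset.prod_insert ha, Finset.sum_insert ha, add_mul,
      Polynomial.coeff_mul_add_eq_of_natDegree_le (Polynomial.natDegree_pow_le_of_le _ (hg a))
        (natDegree_prod_pow_le s g hg e), ih, Polynomial.coeff_pow_of_natDegree_le (hg a)]

lemma IsHomogeneous.sum_eq_of_mem_support [Fintype σ] {F : MvPolynomial σ R} {d : ℕ}
    (hF : F.IsHomogeneous d) {e : σ →₀ ℕ} (he : e ∈ F.support) : ∑ i, e i = d := by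
  rw [hF.degree_eq_sum_deg_support he]
  exact (Finset.sum_subset (Finset.subset_univ _) (by simp)).symm

lemma IsHomogeneous.natDegree_aeval_le [Fintype σ] {F : MvPolynomial σ R} {d m : ℕ}
    (hF : F.IsHomogeneous d) {g : σ → Polynomial R} (hg : ∀ i, (g i).natDegree ≤ m) :
    (MvPolynomial.aeval g F).natDegree ≤ d * m := by
  rw [aeval_def, eval₂_eq']
  refine Polynomial.natDegree_sum_le_of_forall_le _ _ fun e he => ?_
  rw [← hF.sum_eq_of_mem_support he]
  exact (Polynomial.natDegree_C_mul_le _ _).trans (natDegree_prod_pow_le _ g hg _)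

/-- The coefficient of a form along a polynomial curve in the highest possible degree is the value
of the form at the point at infinity of the curve. -/
lemma IsHomogeneous.coeff_aeval [Fintype σ] {F : MvPolynomial σ R} {d m : ℕ}
    (hF : F.IsHomogeneous d) {g : σ → Polynomial R} (hg : ∀ i, (g i).natDegree ≤ m) :
    (MvPolynomial.aeval g F).coeff (d * m) = MvPolynomial.eval (fun i => (g i).coeff m) F := by
  rw [aeval_def, eval₂_eq', eval_eq', Polynomial.finsetSum_coeff]
  refine Finset.sum_congr rfl fun e he => ?_
  rw [← Polynomial.C_eq_algebraMap, Polynomial.coeff_C_mul, ← hF.sum_eq_of_mem_support he,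
    coeff_prod_pow_of_natDegree_le _ g hg]

lemma derivative_aeval [Fintype σ] (g : σ → Polynomial R) (F : MvPolynomial σ R) :
    Polynomial.derivative (aeval g F)
      = ∑ i, aeval g (pderiv i F) * Polynomial.derivative (g i) := by
  classical
  induction F using MvPolynomial.induction_on with
  | C a => simp
  | add p q hp hq =>
    simp only [map_add, hp, hq, add_mul, Finset.sum_add_distrib]
  | mul_X p j hp =>
    rw [map_mul, aeval_X, Polynomial.derivative_mul, hp, Finset.sum_mul]
    have h : ∀ i, aeval g (pderiv i (p * X j)) * Polynomial.derivative (g i)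
        = aeval g (pderiv i p) * Polynomial.derivative (g i) * g j
          + if i = j then aeval g p * Polynomial.derivative (g i) else 0 := fun i => by
      rw [pderiv_mul, pderiv_X, map_add, map_mul, map_mul, aeval_X]
      rcases eq_or_ne i j with rfl | hij
      · rw [Pi.single_eq_same, map_one, if_pos rfl]
        ring
      · rw [Pi.single_eq_of_ne hij.symm, map_zero, if_neg hij]
        ring
    simp only [h, Finset.sum_add_distrib, Finset.sum_ite_eq', Finset.mem_univ, if_true]

lemma IsHomogeneous.aeval_smul {S : Type*} [CommRing S] [Algebra R S] [Fintype σ]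
    {F : MvPolynomial σ R} {d : ℕ} (hF : F.IsHomogeneous d) (c : S) (g : σ → S) :
    MvPolynomial.aeval (fun i => c * g i) F = c ^ d * MvPolynomial.aeval g F := by
  rw [aeval_def, aeval_def, eval₂_eq', eval₂_eq', Finset.mul_sum]
  refine Finset.sum_congr rfl fun e he => ?_
  rw [← hF.sum_eq_of_mem_support he]
  simp only [mul_pow, Finset.prod_mul_distrib, Finset.prod_pow_eq_pow_sum]
  ring

lemma IsHomogeneous.eval_smul [Fintype σ] {F : MvPolynomial σ R} {d : ℕ}
    (hF : F.IsHomogeneous d) (c : R) (x : σ → R) :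
    MvPolynomial.eval (c • x) F = c ^ d * MvPolynomial.eval x F := by
  have := IsHomogeneous.aeval_smul (S := R) hF c x
  rwa [aeval_eq_eval] at this

lemma eval_aeval (g : σ → Polynomial R) (F : MvPolynomial σ R) (t : R) :
    (MvPolynomial.aeval g F).eval t = eval (fun i => (g i).eval t) F := by
  induction F using MvPolynomial.induction_on with
  | C a => simp
  | add p q hp hq => simp [hp, hq]
  | mul_X p j hp => simp [hp]

end MvPolynomial

/-! ### Singular points of plane cubics -/

/-- All first partial derivatives of `F` vanish at `x`. For a form of positive degree over a field
of characteristic zero this says that the point `x` of the affine cone is singular. -/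
def IsSingularAt {R : Type*} [CommRing R] (F : MvPolynomial (Fin 3) R) (x : Fin 3 → R) : Prop :=
  ∀ i, eval x (pderiv i F) = 0

section

variable {K : Type*} [Field K] {F : MvPolynomial (Fin 3) K}

lemma IsSingularAt.eval_eq_zero [CharZero K] (hF : F.IsHomogeneous 3) {x : Fin 3 → K}
    (hx : IsSingularAt F x) : eval x F = 0 := by
  have h := congrArg (eval x) hF.sum_X_mul_pderiv
  simp only [map_sum, map_mul, eval_X, nsmul_eq_mul] at h
  simp only [hx _, mul_zero, Finset.sum_const_zero] at h
  simpa using h.symm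

lemma IsSingularAt.smul (hF : F.IsHomogeneous 3) {x : Fin 3 → K} (hx : IsSingularAt F x) (c : K) :
    IsSingularAt F (c • x) := fun i => by
  rw [hF.pderiv.eval_smul, hx i, mul_zero]

/-- A line through a singular point of a cubic meets it there with multiplicity at least two. -/
lemma IsSingularAt.aeval_line [CharZero K] (hF : F.IsHomogeneous 3) {s : Fin 3 → K}
    (hs : IsSingularAt F s) (v : Fin 3 → K) : ∃ c : K,
    aeval (fun i => Polynomial.C (s i) + Polynomial.X * Polynomial.C (v i)) F
      = Polynomial.C c * Polynomial.X ^ 2 + Polynomial.C (eval v F) * Polynomial.X ^ 3 := by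
  set g : Fin 3 → Polynomial K := fun i => Polynomial.C (s i) + Polynomial.X * Polynomial.C (v i)
    with hg
  have hdeg : ∀ i, (g i).natDegree ≤ 1 := fun i => by
    simp only [hg]
    compute_degree
  have h0 : (aeval g F).coeff 0 = 0 := by
    rw [Polynomial.coeff_zero_eq_eval_zero, eval_aeval]
    simpa [hg] using hs.eval_eq_zero hF
  have h1 : (aeval g F).coeff 1 = 0 := by
    have := Polynomial.coeff_derivative (aeval g F) 0
    rw [Polynomial.coeff_zero_eq_eval_zero, derivative_aeval, Polynomial.eval_finsetSum] at this
    simp only [Polynomial.eval_mul, eval_aeval] at this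
    have h2 : ∀ i, eval (fun j => (g j).eval 0) (pderiv i F) = 0 := fun i => by
      simpa [hg] using hs i
    simp only [h2, zero_mul, Finset.sum_const_zero] at this
    simpa using this.symm
  have h3 : (aeval g F).coeff 3 = eval v F := by
    have := hF.coeff_aeval hdeg
    simpa [hg, Polynomial.coeff_C] using this
  refine ⟨(aeval g F).coeff 2, ?_⟩
  conv_lhs => rw [(aeval g F).as_sum_range_C_mul_X_pow' (n := 4)
    ((hF.natDegree_aeval_le hdeg).trans_lt (by norm_num))]
  simp [Finset.sum_range_succ, h0, h1, h3]

/-- If two points of a plane cubic are singular, then the line joining them meets the cubic with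
multiplicity at least four, so it lies on the cubic. -/
lemma IsSingularAt.eval_add_smul_eq_zero [CharZero K] (hF : F.IsHomogeneous 3) {s u : Fin 3 → K}
    (hs : IsSingularAt F s) (hu : IsSingularAt F u) (a b : K) : eval (a • s + b • u) F = 0 := by
  obtain ⟨c, hc⟩ := hs.aeval_line hF u
  obtain ⟨c', hc'⟩ := hu.aeval_line hF s
  rw [hu.eval_eq_zero hF] at hc
  rw [hs.eval_eq_zero hF] at hc'
  have key : ∀ t : K, eval (s + t • u) F = c * t ^ 2 := fun t => by
    have := congrArg (Polynomial.eval t) hc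
    rw [eval_aeval] at this
    simp only [Polynomial.eval_add, Polynomial.eval_mul, Polynomial.eval_C, Polynomial.eval_X,
      Polynomial.eval_pow, zero_mul, add_zero] at this
    rw [← this]
    rfl
  have key' : ∀ t : K, eval (u + t • s) F = c' * t ^ 2 := fun t => by
    have := congrArg (Polynomial.eval t) hc'
    rw [eval_aeval] at this
    simp only [Polynomial.eval_add, Polynomial.eval_mul, Polynomial.eval_C, Polynomial.eval_X,
      Polynomial.eval_pow, zero_mul, add_zero] at this
    rw [← this]
    rfl
  have h : ∀ t : K, t ≠ 0 → c * t ^ 2 = c' * t := fun t ht => by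
    rw [← key, show s + t • u = t • (u + t⁻¹ • s) by
      rw [smul_add, smul_smul, mul_inv_cancel₀ ht, one_smul, add_comm], hF.eval_smul, key']
    field_simp
  have h1 := h 1 one_ne_zero
  have h2 := h 2 two_ne_zero
  have hc0 : c = 0 := by linear_combination (h2 - 2 * h1) / 2
  by_cases ha : a = 0
  · rw [ha, zero_smul, zero_add, hF.eval_smul, hu.eval_eq_zero hF, mul_zero]
  · rw [show a • s + b • u = a • (s + (a⁻¹ * b) • u) by
      rw [smul_add, smul_smul, mul_inv_cancel_left₀ ha], hF.eval_smul, key, hc0, zero_mul, mul_zero]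

/-- A polynomial vanishing on the zero set of a nonzero linear form is divisible by that form. -/
lemma dvd_of_eval_eq_zero_of_linear [Infinite K] {ℓ : Fin 3 → K} (hℓ : ℓ ≠ 0)
    (h : ∀ x : Fin 3 → K, ∑ i, ℓ i * x i = 0 → eval x F = 0) :
    (∑ i, C (ℓ i) * X i) ∣ F := by
  classical
  obtain ⟨k, hk⟩ := Function.ne_iff.mp hℓ
  simp only [Pi.zero_apply] at hk
  set L : MvPolynomial (Fin 3) K := ∑ i, C (ℓ i) * X i with hL
  -- the projection onto the zero set of the linear form along the `k`-th coordinate axis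
  set φ : Fin 3 → MvPolynomial (Fin 3) K := fun i =>
    X i - Pi.single (M := fun _ => _) k (C (ℓ k)⁻¹ * L) i with hφ
  have h0 : aeval φ F = 0 := by
    refine MvPolynomial.funext fun x => ?_
    have h1 : eval x (aeval φ F) = eval (fun i => eval x (φ i)) F := by
      simpa [aeval_eq_eval] using comp_aeval_apply φ (aeval x) F
    rw [map_zero, h1]
    apply h
    have h2 : ∀ i, eval x (φ i) = x i - Pi.single (M := fun _ => K) k ((ℓ k)⁻¹ * ∑ j, ℓ j * x j) i :=
      fun i => by
        rcases eq_or_ne i k with rfl | hik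
        · simp [hφ, hL]
        · simp [hφ, Pi.single_eq_of_ne hik]
    simp only [h2, mul_sub, Finset.sum_sub_distrib]
    rw [Finset.sum_eq_single (f := fun i => ℓ i * Pi.single (M := fun _ => K) k _ i) k]
    · rw [Pi.single_eq_same, mul_inv_cancel_left₀ hk, sub_self]
    · intro i _ hik
      rw [Pi.single_eq_of_ne hik, mul_zero]
    · simp
  have hq : Ideal.Quotient.mk (Ideal.span {L}) F
      = Ideal.Quotient.mk (Ideal.span {L}) (aeval φ F) := by
    have h1 := comp_aeval_apply φ (Ideal.Quotient.mkₐ K (Ideal.span {L})) F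
    have h2 := comp_aeval_apply X (Ideal.Quotient.mkₐ K (Ideal.span {L})) F
    have h3 : ∀ i, Ideal.Quotient.mkₐ K (Ideal.span {L}) (φ i)
        = Ideal.Quotient.mkₐ K (Ideal.span {L}) (X i) := fun i => by
      rw [Ideal.Quotient.mkₐ_eq_mk, Ideal.Quotient.eq, Ideal.mem_span_singleton]
      rcases eq_or_ne i k with rfl | hik
      · simp [hφ]
      · simp [hφ, Pi.single_eq_of_ne hik]
    simp only [h3] at h1
    rw [aeval_X_left_apply, ← h1] at h2
    exact h2
  rw [h0, Ideal.Quotient.eq, sub_zero, Ideal.mem_span_singleton] at hq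
  exact hq

end

/-! ### Rational cubics are singular -/

section

variable {K : Type*} [Field K]

/-- Removing the greatest common divisor from a polynomial vector leaves a unimodular vector. -/
lemma exists_eq_mul_and_sum_mul_eq_one (G : Fin 3 → Polynomial K) :
    ∃ (d : Polynomial K) (g a : Fin 3 → Polynomial K),
      (∀ i, G i = d * g i) ∧ ∑ i, a i * g i = 1 := by
  set I : Ideal (Polynomial K) := Ideal.span (Set.range G) with hI
  obtain ⟨d, hd⟩ : ∃ d, I = Ideal.span {d} := (IsPrincipalIdealRing.principal I).principal
  by_cases h0 : d = 0
  · refine ⟨0, fun _ => 1, Pi.single 0 1, fun i => ?_, by simp⟩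
    have : G i ∈ I := Ideal.subset_span ⟨i, rfl⟩
    rw [hd, h0, Ideal.mem_span_singleton, zero_dvd_iff] at this
    rw [this, zero_mul]
  · have h1 : ∀ i, d ∣ G i := fun i => by
      rw [← Ideal.mem_span_singleton, ← hd]
      exact Ideal.subset_span ⟨i, rfl⟩
    choose g hg using h1
    have h2 : d ∈ I := hd ▸ Ideal.mem_span_singleton_self d
    obtain ⟨a, ha⟩ := Ideal.mem_span_range_iff_exists_fun.mp h2
    refine ⟨d, g, a, hg, mul_left_cancel₀ h0 ?_⟩
    rw [mul_one, ← ha, Finset.mul_sum, ha]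
    refine Eq.trans (Finset.sum_congr rfl fun i _ => ?_) ha
    rw [hg i]
    ring

lemma exists_sum_mul_eq_one_of_eval_ne_zero [IsAlgClosed K] {N : Fin 3 → Polynomial K}
    (h : ∀ t, ∃ i, (N i).eval t ≠ 0) : ∃ b : Fin 3 → Polynomial K, ∑ i, b i * N i = 1 := by
  obtain ⟨d, g, a, hg, ha⟩ := exists_eq_mul_and_sum_mul_eq_one N
  have hd : d.degree = 0 := by
    by_contra hd
    obtain ⟨t, ht⟩ := IsAlgClosed.exists_root d hd
    obtain ⟨i, hi⟩ := h t
    rw [hg, Polynomial.eval_mul, ht.eq_zero, zero_mul] at hi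
    exact hi rfl
  obtain ⟨c, hc⟩ := (Polynomial.isUnit_iff_degree_eq_zero.mpr hd).exists_left_inv
  refine ⟨fun i => c * a i, ?_⟩
  calc ∑ i, c * a i * N i = (c * d) * ∑ i, a i * g i := by
        rw [Finset.mul_sum]
        exact Finset.sum_congr rfl fun i _ => by rw [hg i]; ring
    _ = 1 := by rw [hc, ha, one_mul]

/-- If `u` and `v` are orthogonal to a unimodular vector `N`, their cross product is a multiple
of `N`. -/
lemma exists_cross_eq_mul {A : Type*} [CommRing A] {u v N b : Fin 3 → A}
    (hb : ∑ i, b i * N i = 1) (hu : ∑ i, N i * u i = 0) (hv : ∑ i, N i * v i = 0) :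
    ∃ w, u 1 * v 2 - u 2 * v 1 = w * N 0 ∧ u 2 * v 0 - u 0 * v 2 = w * N 1 ∧
      u 0 * v 1 - u 1 * v 0 = w * N 2 := by
  simp only [Fin.sum_univ_three] at hb hu hv
  have h01 : N 0 * (u 2 * v 0 - u 0 * v 2) = N 1 * (u 1 * v 2 - u 2 * v 1) := by
    linear_combination u 2 * hv - v 2 * hu
  have h02 : N 0 * (u 0 * v 1 - u 1 * v 0) = N 2 * (u 1 * v 2 - u 2 * v 1) := by
    linear_combination v 1 * hu - u 1 * hv
  have h12 : N 1 * (u 0 * v 1 - u 1 * v 0) = N 2 * (u 2 * v 0 - u 0 * v 2) := by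
    linear_combination u 0 * hv - v 0 * hu
  refine ⟨b 0 * (u 1 * v 2 - u 2 * v 1) + b 1 * (u 2 * v 0 - u 0 * v 2)
    + b 2 * (u 0 * v 1 - u 1 * v 0), ?_, ?_, ?_⟩
  · linear_combination -(u 1 * v 2 - u 2 * v 1) * hb - b 1 * h01 - b 2 * h02
  · linear_combination -(u 2 * v 0 - u 0 * v 2) * hb + b 0 * h01 - b 2 * h12
  · linear_combination -(u 0 * v 1 - u 1 * v 0) * hb + b 0 * h02 + b 1 * h12

/-- A polynomial curve without zeros on a smooth plane cubic is constant. The vector `N` of the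
partial derivatives of the cubic along the curve `g` has no zeros and is orthogonal to `g` and `g'`,
hence `g × g'` is a polynomial multiple of `N`. If `m` is the degree of `g`, the degree of `N` is
`2 * m`, including at infinity, while that of `g × g'` is smaller; so `g × g' = 0`. -/
lemma derivative_eq_zero_of_smooth_cubic [IsAlgClosed K] [CharZero K] {F : MvPolynomial (Fin 3) K}
    (hF : F.IsHomogeneous 3) (hsm : ∀ s, IsSingularAt F s → s = 0) {g a : Fin 3 → Polynomial K}
    (ha : ∑ i, a i * g i = 1) (hg : aeval g F = 0) (i : Fin 3) :
    Polynomial.derivative (g i) = 0 := by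
  obtain ⟨N, hN⟩ : ∃ N : Fin 3 → Polynomial K, ∀ i, N i = aeval g (pderiv i F) := ⟨_, fun _ => rfl⟩
  obtain ⟨b, hb⟩ : ∃ b : Fin 3 → Polynomial K, ∑ i, b i * N i = 1 := by
    refine exists_sum_mul_eq_one_of_eval_ne_zero fun t => ?_
    by_contra! hcon
    have h0 := hsm (fun i => (g i).eval t) fun i => by rw [← eval_aeval, ← hN]; exact hcon i
    have h1 := congrArg (Polynomial.eval t) ha
    simp only [Polynomial.eval_finsetSum, Polynomial.eval_mul, Polynomial.eval_one,
      fun i => show (g i).eval t = 0 from congrFun h0 i, mul_zero, Finset.sum_const_zero] at h1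
    exact zero_ne_one h1
  have hNg : ∑ i, N i * g i = 0 := by
    have h := congrArg (aeval g) hF.sum_X_mul_pderiv
    simp only [map_sum, map_mul, aeval_X, map_nsmul, hg, smul_zero] at h
    rw [← h]
    exact Finset.sum_congr rfl fun i _ => by rw [hN, mul_comm]
  have hNg' : ∑ i, N i * Polynomial.derivative (g i) = 0 := by
    simp only [hN]
    rw [← derivative_aeval, hg, Polynomial.derivative_zero]
  obtain ⟨w, hw12, hw20, hw01⟩ := exists_cross_eq_mul hb hNg hNg'
  obtain ⟨k, -, hk⟩ := Finset.exists_max_image Finset.univ (fun i => (g i).natDegree) ⟨0, by simp⟩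
  set m := (g k).natDegree with hm
  have hdeg : ∀ i, (g i).natDegree ≤ m := fun i => hk i (Finset.mem_univ i)
  rcases Nat.eq_zero_or_pos m with hm0 | hm0
  · exact Polynomial.derivative_of_natDegree_zero (Nat.le_zero.mp (hm0 ▸ hdeg i))
  have hw0 : w = 0 := by
    by_contra hw0
    have hlc : (fun i => (g i).coeff m) ≠ 0 := fun h => by
      have h1 : g k = 0 := Polynomial.leadingCoeff_eq_zero.mp (congrFun h k)
      rw [hm, h1, Polynomial.natDegree_zero] at hm0
      exact hm0.false
    obtain ⟨j, hj⟩ : ∃ j, eval (fun i => (g i).coeff m) (pderiv j F) ≠ 0 := by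
      by_contra! hcon
      exact hlc (hsm _ hcon)
    rw [← hF.pderiv.coeff_aeval hdeg, ← hN] at hj
    have h1 : 2 * m ≤ (N j).natDegree := Polynomial.le_natDegree_of_ne_zero hj
    have hNj : N j ≠ 0 := fun h => hj (by rw [h, Polynomial.coeff_zero])
    have h2 : (N j).natDegree ≤ (w * N j).natDegree := by
      rw [Polynomial.natDegree_mul hw0 hNj]
      exact Nat.le_add_left _ _
    have h3 : ∀ i j, (g i * Polynomial.derivative (g j)).natDegree ≤ m + (m - 1) := fun i j =>
      Polynomial.natDegree_mul_le_of_le (hdeg i)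
        ((Polynomial.natDegree_derivative_le _).trans (Nat.sub_le_sub_right (hdeg j) 1))
    have h4 : ∀ i j, (g i * Polynomial.derivative (g j)
        - g j * Polynomial.derivative (g i)).natDegree ≤ m + (m - 1) := fun i j =>
      (Polynomial.natDegree_sub_le_of_le (h3 i j) (h3 j i)).trans (max_self _).le
    have h5 : (w * N j).natDegree ≤ m + (m - 1) := by
      fin_cases j
      · exact hw12 ▸ h4 1 2
      · exact hw20 ▸ h4 2 0
      · exact hw01 ▸ h4 0 1
    omega
  rw [hw0, zero_mul] at hw12 hw20 hw01
  have hpar : ∀ i j, g j * Polynomial.derivative (g i) = g i * Polynomial.derivative (g j) := by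
    simp only [Fin.forall_fin_succ, Fin.forall_fin_zero, and_true, Fin.succ_zero_eq_one,
      Fin.succ_one_eq_two]
    refine ⟨⟨trivial, ?_, ?_⟩, ⟨?_, trivial, ?_⟩, ⟨?_, ?_⟩⟩
    · linear_combination -hw01
    · linear_combination hw20
    · linear_combination hw01
    · linear_combination -hw12
    · linear_combination -hw20
    · linear_combination hw12
  by_cases hi : g i = 0
  · rw [hi, Polynomial.derivative_zero]
  refine Polynomial.eq_zero_of_dvd_of_degree_lt (p := g i) ?_ (Polynomial.degree_derivative_lt hi)
  refine ⟨∑ j, a j * Polynomial.derivative (g j), ?_⟩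
  calc Polynomial.derivative (g i) = (∑ j, a j * g j) * Polynomial.derivative (g i) := by
        rw [ha, one_mul]
    _ = g i * ∑ j, a j * Polynomial.derivative (g j) := by
        rw [Finset.sum_mul, Finset.mul_sum]
        exact Finset.sum_congr rfl fun j _ => by rw [mul_assoc, hpar i j]; ring

end

/-- Every polynomial curve on a smooth plane cubic has constant image in the projective plane. -/
lemma exists_eq_mul_C_of_smooth_cubic {K : Type*} [Field K] [IsAlgClosed K] [CharZero K]
    {F : MvPolynomial (Fin 3) K} (hF : F.IsHomogeneous 3) (hsm : ∀ s, IsSingularAt F s → s = 0)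
    {G : Fin 3 → Polynomial K} (hG : aeval G F = 0) :
    ∃ (d : Polynomial K) (u : Fin 3 → K), G = fun i => d * Polynomial.C (u i) := by
  obtain ⟨d, g, a, hd, ha⟩ := exists_eq_mul_and_sum_mul_eq_one G
  by_cases hd0 : d = 0
  · exact ⟨0, 0, funext fun i => by rw [hd, hd0, zero_mul, zero_mul]⟩
  have hgF : aeval g F = 0 := by
    rw [funext hd, hF.aeval_smul] at hG
    exact (mul_eq_zero.mp hG).resolve_left (pow_ne_zero _ hd0)
  refine ⟨d, fun i => (g i).coeff 0, funext fun i => ?_⟩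
  rw [hd, ← Polynomial.eq_C_of_natDegree_eq_zero
    (Polynomial.derivative_eq_zero.mp (derivative_eq_zero_of_smooth_cubic hF hsm ha hgF i))]

/-- Two forms of the same degree have a constant ratio along a polynomial curve with constant image
in the projective plane. -/
lemma aeval_eq_zero_of_eq_mul_C {K : Type*} [Field K] {p q : MvPolynomial (Fin 3) K} {n : ℕ}
    (hp : p.IsHomogeneous n) (hq : q.IsHomogeneous n) {G : Fin 3 → Polynomial K} {d : Polynomial K}
    {u : Fin 3 → K} (hG : G = fun i => d * Polynomial.C (u i)) {a b : K}
    (hrel : aeval G p * (Polynomial.C b + Polynomial.X) = Polynomial.C a * aeval G q) :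
    aeval G p = 0 := by
  have hconst : ∀ r : MvPolynomial (Fin 3) K, r.IsHomogeneous n →
      aeval G r = d ^ n * Polynomial.C (eval u r) := fun r hr => by
    rw [hG, hr.aeval_smul]
    congr 1
    exact (comp_aeval_apply u (Algebra.ofId K (Polynomial K)) r).symm
  rw [hconst p hp, hconst q hq] at hrel
  rw [hconst p hp]
  by_cases hd : d ^ n = 0
  · rw [hd, zero_mul]
  have hrel' : Polynomial.C (eval u p) * (Polynomial.C b + Polynomial.X)
      = Polynomial.C a * Polynomial.C (eval u q) :=
    mul_left_cancel₀ hd (by linear_combination hrel)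
  have h1 : eval u p = 0 := by
    have h2 := congrArg (Polynomial.eval (-b + 1)) hrel'
    have h3 := congrArg (Polynomial.eval (-b)) hrel'
    simp only [Polynomial.eval_mul, Polynomial.eval_add, Polynomial.eval_C, Polynomial.eval_X]
      at h2 h3
    linear_combination h2 - h3
  rw [h1, Polynomial.C_0, mul_zero]

/-- A smooth plane cubic is not rational. -/
lemma IsRationalPlaneCurve.exists_isSingularAt {F : MvPolynomial (Fin 3) ℂ}
    (h : IsRationalPlaneCurve 3 F) : ∃ s, s ≠ 0 ∧ IsSingularAt F s := by
  obtain ⟨hF, -, m, n, g, h, c, -, hh, hc, hg, hinv⟩ := h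
  by_contra! hcon
  have hsm : ∀ s, IsSingularAt F s → s = 0 := fun s hs => by_contra fun h0 => hcon s h0 hs
  obtain ⟨v, hv⟩ : ∃ v, eval v (c * X 0) ≠ 0 := by
    by_contra! hcon
    exact mul_ne_zero hc (X_ne_zero 0) (MvPolynomial.funext fun v => by rw [hcon v, map_zero])
  rw [map_mul, eval_X] at hv
  -- restriction to an affine line of parameters that misses the origin, on which `c` is not zero
  obtain ⟨ℓ, hℓ0, hℓ1⟩ : ∃ ℓ : Fin 2 → Polynomial ℂ,
      ℓ 0 = Polynomial.C (v 0) ∧ ℓ 1 = Polynomial.C (v 1) + Polynomial.X := ⟨![_, _], rfl, rfl⟩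
  obtain ⟨G, hcomp⟩ : ∃ G : Fin 3 → Polynomial ℂ,
      ∀ P : MvPolynomial (Fin 3) ℂ, aeval G P = aeval ℓ (aeval g P) :=
    ⟨fun i => aeval ℓ (g i), fun P => (comp_aeval_apply g (aeval ℓ) P).symm⟩
  have hGF : aeval G F = 0 := by rw [hcomp, hg, map_zero]
  have hGh : ∀ j, aeval G (h j) = aeval ℓ c * ℓ j := fun j => by
    rw [hcomp, hinv, map_mul, aeval_X]
  have hc' : aeval ℓ c ≠ 0 := fun h0 => by
    have h1 := congrArg (Polynomial.eval 0) h0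
    rw [eval_aeval, show (fun i => (ℓ i).eval 0) = v by
      funext i; fin_cases i <;> simp [hℓ0, hℓ1], Polynomial.eval_zero] at h1
    exact left_ne_zero_of_mul hv h1
  obtain ⟨d, u, hGd⟩ := exists_eq_mul_C_of_smooth_cubic hF hsm hGF
  have hv0 : Polynomial.C (v 0) ≠ 0 := Polynomial.C_ne_zero.mpr (right_ne_zero_of_mul hv)
  have hG0 : aeval G (h 0) ≠ 0 := by
    rw [hGh, hℓ0]
    exact mul_ne_zero hc' hv0
  have hrel : aeval G (h 0) * (Polynomial.C (v 1) + Polynomial.X)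
      = Polynomial.C (v 0) * aeval G (h 1) := by
    rw [hGh, hGh, hℓ0, hℓ1]
    ring
  exact hG0 (aeval_eq_zero_of_eq_mul_C (hh 0) (hh 1) hGd hrel)

/-! ### Real rational cubics have a real singular point -/

lemma exists_eq_smul_add_smul_of_cross {K : Type*} [Field K] {u v x : Fin 3 → K}
    (h : crossProduct u v ≠ 0) (hx : ∑ i, crossProduct u v i * x i = 0) :
    ∃ a b : K, x = a • u + b • v := by
  obtain ⟨k, hk⟩ := Function.ne_iff.mp h
  rw [Pi.zero_apply] at hk
  have key : ∀ i, crossProduct u v k * x i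
      = crossProduct x v k * u i + crossProduct u x k * v i := by
    intro i
    simp only [cross_apply, Fin.sum_univ_three, Matrix.cons_val] at hx ⊢
    fin_cases k <;> fin_cases i <;> simp only [Fin.zero_eta, Fin.mk_one, Fin.reduceFinMk,
      Matrix.cons_val] <;> first | ring1 | linear_combination hx
  refine ⟨crossProduct x v k / crossProduct u v k, crossProduct u x k / crossProduct u v k,
    funext fun i => mul_left_cancel₀ hk ?_⟩
  rw [key i]
  simp only [Pi.add_apply, Pi.smul_apply, smul_eq_mul]
  field_simp

/-- An irreducible cubic has at most one singular point. -/
lemma IsSingularAt.cross_eq_zero {K : Type*} [Field K] [CharZero K] {F : MvPolynomial (Fin 3) K}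
    (hF : F.IsHomogeneous 3) (hirr : Irreducible F) {s u : Fin 3 → K} (hs : IsSingularAt F s)
    (hu : IsSingularAt F u) : crossProduct s u = 0 := by
  by_contra hsu
  obtain ⟨q, hq⟩ := dvd_of_eval_eq_zero_of_linear (F := F) hsu fun x hx => by
    obtain ⟨a, b, rfl⟩ := exists_eq_smul_add_smul_of_cross hsu hx
    exact hs.eval_add_smul_eq_zero hF hu a b
  rcases hirr.isUnit_or_isUnit hq with hL | hL
  · have := hL.map (eval (0 : Fin 3 → K))
    simp at this
  · obtain ⟨c, -, rfl⟩ := MvPolynomial.isUnit_iff_eq_C_of_isReduced.mp hL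
    have h1 : F.IsHomogeneous (1 + 0) := by
      rw [hq]
      exact (IsHomogeneous.sum _ _ _ fun i _ => isHomogeneous_C_mul_X _ i).mul (isHomogeneous_C _ c)
    have := hF.inj_right h1 hirr.ne_zero
    omega

lemma eval_complexify (F : MvPolynomial (Fin 3) ℝ) (x : Fin 3 → ℂ) :
    eval x (complexify F) = aeval x F := by
  rw [complexify, eval_map, aeval_def]

lemma eval_star_complexify (F : MvPolynomial (Fin 3) ℝ) (x : Fin 3 → ℂ) :
    eval (star x) (complexify F) = star (eval x (complexify F)) := by
  rw [eval_complexify, eval_complexify]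
  exact (comp_aeval_apply x Complex.conjAe.toAlgHom F).symm

lemma eval_ofReal_complexify (F : MvPolynomial (Fin 3) ℝ) (x : Fin 3 → ℝ) :
    eval (fun i => (x i : ℂ)) (complexify F) = (eval x F : ℝ) := by
  rw [eval_complexify]
  exact (comp_aeval_apply x Complex.ofRealAm F).symm

lemma pderiv_complexify (F : MvPolynomial (Fin 3) ℝ) (i : Fin 3) :
    pderiv i (complexify F) = complexify (pderiv i F) := pderiv_map

/-- The singular point of a real rational cubic is real, since it is equal to its conjugate. -/
lemma IsRationalPlaneCurve.exists_real_isSingularAt {F : MvPolynomial (Fin 3) ℝ}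
    (h : IsRationalPlaneCurve 3 (complexify F)) : ∃ s : Fin 3 → ℝ, s ≠ 0 ∧ IsSingularAt F s := by
  obtain ⟨s, hs0, hs⟩ := h.exists_isSingularAt
  have hs' : IsSingularAt (complexify F) (star s) := fun i => by
    rw [pderiv_complexify, eval_star_complexify, ← pderiv_complexify, hs i, star_zero]
  have hcross := hs.cross_eq_zero h.1 h.2.1 hs'
  obtain ⟨k, hk⟩ := Function.ne_iff.mp hs0
  rw [Pi.zero_apply] at hk
  have hsym : ∀ i j, s i * star (s j) = s j * star (s i) := by
    have h0 := congrFun hcross 0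
    have h1 := congrFun hcross 1
    have h2 := congrFun hcross 2
    simp only [cross_apply, Matrix.cons_val, Pi.star_apply, Pi.zero_apply] at h0 h1 h2
    simp only [Fin.forall_fin_succ, Fin.forall_fin_zero, and_true, Fin.succ_zero_eq_one,
      Fin.succ_one_eq_two]
    refine ⟨⟨trivial, ?_, ?_⟩, ⟨?_, trivial, ?_⟩, ⟨?_, ?_⟩⟩
    · linear_combination h2
    · linear_combination -h1
    · linear_combination -h2
    · linear_combination h0
    · linear_combination h1
    · linear_combination -h0
  -- the multiple of `s` by the conjugate of `s k` is real
  have hreal : ∀ i, (((star (s k) • s) i).re : ℂ) = (star (s k) • s) i := fun i => by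
    rw [← Complex.conj_eq_iff_re]
    simp only [Pi.smul_apply, smul_eq_mul, map_mul]
    have := hsym i k
    simp only [Complex.star_def, Complex.conj_conj] at this ⊢
    linear_combination -this
  refine ⟨fun i => ((star (s k) • s) i).re, fun h0 => ?_, fun i => ?_⟩
  · have h1 := hreal k
    rw [congrFun h0 k] at h1
    exact mul_ne_zero (star_ne_zero.mpr hk) hk (by simpa using h1.symm)
  · have h1 := hs.smul h.1 (star (s k)) i
    rw [pderiv_complexify, ← funext hreal, eval_ofReal_complexify] at h1
    exact_mod_cast h1

/-! ### Cubics through points of the empty conic -/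

/-- The parametrization of the affine cone over the empty conic. -/
def conicParam (a b : ℂ) : Fin 3 → ℂ :=
  ![a ^ 2 - b ^ 2, Complex.I * (a ^ 2 + b ^ 2), 2 * a * b]

lemma exists_eq_conicParam {q : Fin 3 → ℂ} (hq : q 0 ^ 2 + q 1 ^ 2 + q 2 ^ 2 = 0) :
    ∃ a b, q = conicParam a b := by
  obtain ⟨a, ha⟩ := IsAlgClosed.exists_pow_nat_eq ((q 0 - Complex.I * q 1) / 2) two_pos
  obtain ⟨b, hb⟩ := IsAlgClosed.exists_pow_nat_eq ((-Complex.I * q 1 - q 0) / 2) two_pos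
  have hI := Complex.I_sq
  have h0 : q 0 = a ^ 2 - b ^ 2 := by rw [ha, hb]; ring
  have h1 : q 1 = Complex.I * (a ^ 2 + b ^ 2) := by
    rw [ha, hb]
    linear_combination q 1 * hI
  have h2 : (q 2 - 2 * a * b) * (q 2 + 2 * a * b) = 0 := by
    have h3 : (2 * a * b) ^ 2 = 4 * (a ^ 2) * (b ^ 2) := by ring
    rw [ha, hb] at h3
    linear_combination hq - h3 - q 1 ^ 2 * hI
  rcases mul_eq_zero.mp h2 with h | h
  · refine ⟨a, b, funext fun i => ?_⟩
    fin_cases i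
    · exact h0
    · exact h1
    · exact sub_eq_zero.mp h
  · refine ⟨a, -b, funext fun i => ?_⟩
    fin_cases i
    · simpa [conicParam] using h0
    · simpa [conicParam] using h1
    · simpa [conicParam] using eq_neg_of_add_eq_zero_left h

lemma conicParam_mul (c a b : ℂ) : conicParam (c * a) (c * b) = c ^ 2 • conicParam a b := by
  funext i
  fin_cases i <;> simp [conicParam] <;> ring

/-- A cubic through eight points of the empty conic contains the conic, as it would meet it in at
most six points otherwise. -/
lemma eval_eq_zero_of_conic {ι : Type*} [Fintype ι] (hι : 8 ≤ Fintype.card ι)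
    {G : MvPolynomial (Fin 3) ℂ} (hG : G.IsHomogeneous 3) {v : ι → Fin 3 → ℂ}
    (hv : ∀ i j, ∀ c : ℂ, v i = c • v j → i = j)
    (hvQ : ∀ i, v i 0 ^ 2 + v i 1 ^ 2 + v i 2 ^ 2 = 0) (hvG : ∀ i, eval (v i) G = 0)
    {q : Fin 3 → ℂ} (hq : q 0 ^ 2 + q 1 ^ 2 + q 2 ^ 2 = 0) : eval q G = 0 := by
  classical
  choose a b hab using fun i => exists_eq_conicParam (hvQ i)
  set g : Fin 3 → Polynomial ℂ := ![Polynomial.X ^ 2 - 1,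
    Polynomial.C Complex.I * (Polynomial.X ^ 2 + 1), Polynomial.C 2 * Polynomial.X] with hg
  have hdeg : ∀ i, (g i).natDegree ≤ 2 := by
    intro i
    fin_cases i <;> simp only [hg, Fin.zero_eta, Fin.mk_one, Fin.reduceFinMk, Matrix.cons_val] <;>
      compute_degree!
  have hgeval : ∀ t, (aeval g G).eval t = eval (conicParam t 1) G := fun t => by
    rw [eval_aeval]
    congr 2
    funext i
    fin_cases i <;> simp [hg, conicParam]
  have hscale : ∀ x y : ℂ, y ≠ 0 → conicParam x y = y ^ 2 • conicParam (x / y) 1 := fun x y hy => by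
    rw [← conicParam_mul, mul_div_cancel₀ x hy, mul_one]
  set S : Finset ι := Finset.univ.filter fun i => b i ≠ 0 with hS
  -- at most one of the points is the point `[1 : I : 0]` with parameter at infinity
  have hcard : 7 ≤ S.card := by
    have h1 : Sᶜ.card ≤ 1 := by
      refine Finset.card_le_one.mpr fun i hi j hj => ?_
      simp only [hS, Finset.mem_compl, ne_eq, not_not, Finset.mem_filter, Finset.mem_univ, true_and]
        at hi hj
      by_cases haj : a j = 0
      · refine (hv j i 0 ?_).symm
        rw [hab j, hj, haj, zero_smul]
        funext k
        fin_cases k <;> simp [conicParam]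
      · refine hv i j ((a i / a j) ^ 2) ?_
        rw [hab i, hab j, hi, hj, ← conicParam_mul, div_mul_cancel₀ _ haj, mul_zero]
    have h2 := Finset.card_add_card_compl S
    omega
  have hp : aeval g G = 0 := by
    refine Polynomial.eq_zero_of_natDegree_lt_card_of_eval_eq_zero _
      (f := fun i : S => a i / b i) ?_ ?_ ?_
    · rintro ⟨i, hi⟩ ⟨j, hj⟩ hij
      simp only [hS, Finset.mem_filter, Finset.mem_univ, true_and] at hi hj hij
      refine Subtype.ext (hv i j (b i ^ 2 * (b j ^ 2)⁻¹) ?_)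
      rw [hab i, hab j, hscale _ _ hi, hscale _ _ hj, hij, smul_smul,
        inv_mul_cancel_right₀ (pow_ne_zero 2 hj)]
    · rintro ⟨i, hi⟩
      simp only [hS, Finset.mem_filter, Finset.mem_univ, true_and] at hi
      have h1 := hvG i
      rw [hab i, hscale _ _ hi, hG.eval_smul] at h1
      rw [hgeval]
      exact (mul_eq_zero.mp h1).resolve_left (pow_ne_zero _ (pow_ne_zero _ hi))
    · rw [Fintype.card_coe]
      have := hG.natDegree_aeval_le hdeg
      omega
  obtain ⟨x, y, rfl⟩ := exists_eq_conicParam hq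
  by_cases hy : y = 0
  · have h1 := hG.coeff_aeval hdeg
    rw [hp, Polynomial.coeff_zero, show (fun i => (g i).coeff 2) = conicParam 1 0 by
      funext i
      fin_cases i <;> simp [hg, conicParam, Polynomial.coeff_one]] at h1
    rw [hy, show conicParam x 0 = x ^ 2 • conicParam 1 0 by
      rw [← conicParam_mul, mul_one, mul_zero], hG.eval_smul, ← h1, mul_zero]
  · rw [hscale _ _ hy, hG.eval_smul, ← hgeval, hp, Polynomial.eval_zero, mul_zero]

/-- A real cubic that contains the empty conic is the union of the conic and a real line, and so it
has no real singular point. The proof looks at the real lines through a real singular point: each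
of them meets the conic in two nonreal points, so it lies on the cubic. -/
lemma eq_zero_of_conic_of_isSingularAt {F : MvPolynomial (Fin 3) ℝ} (hF : F.IsHomogeneous 3)
    (hQ : ∀ q : Fin 3 → ℂ, q 0 ^ 2 + q 1 ^ 2 + q 2 ^ 2 = 0 → eval q (complexify F) = 0)
    {s : Fin 3 → ℝ} (hs0 : s ≠ 0) (hs : IsSingularAt F s) : F = 0 := by
  refine MvPolynomial.funext fun v => ?_
  rw [map_zero]
  set A := v 0 ^ 2 + v 1 ^ 2 + v 2 ^ 2 with hA
  set B := s 0 * v 0 + s 1 * v 1 + s 2 * v 2 with hB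
  set C := s 0 ^ 2 + s 1 ^ 2 + s 2 ^ 2 with hC
  have hC0 : 0 < C := by
    obtain ⟨k, hk⟩ := Function.ne_iff.mp hs0
    have := sq_pos_of_ne_zero hk
    fin_cases k <;> simp only [Fin.zero_eta, Fin.mk_one, Fin.reduceFinMk] at this <;>
      nlinarith [sq_nonneg (s 0), sq_nonneg (s 1), sq_nonneg (s 2)]
  have hgram : (C * v 0 - B * s 0) ^ 2 + (C * v 1 - B * s 1) ^ 2 + (C * v 2 - B * s 2) ^ 2
      = C * (A * C - B ^ 2) := by
    simp only [hA, hB, hC]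
    ring
  rcases le_or_gt (A * C - B ^ 2) 0 with hD | hD
  · have hle := mul_nonpos_of_nonneg_of_nonpos hC0.le hD
    have h0 := sq_nonneg (C * v 0 - B * s 0)
    have h1 := sq_nonneg (C * v 1 - B * s 1)
    have h2 := sq_nonneg (C * v 2 - B * s 2)
    have hz : ∀ i, C * v i - B * s i = 0 := by
      intro i
      refine pow_eq_zero_iff two_ne_zero |>.mp ?_
      fin_cases i <;> simp only [Fin.zero_eta, Fin.mk_one, Fin.reduceFinMk] <;> linarith
    have hv : v = (B / C) • s := funext fun i => by
      simp only [Pi.smul_apply, smul_eq_mul]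
      field_simp
      linarith [hz i]
    rw [hv, hF.eval_smul, hs.eval_eq_zero hF, mul_zero]
  · have hA0 : A ≠ 0 := by
      rintro h
      rw [h] at hD
      nlinarith [sq_nonneg B]
    set D := √(A * C - B ^ 2) with hDdef
    have hD0 : 0 < D := Real.sqrt_pos.mpr hD
    have hDsq : D ^ 2 = A * C - B ^ 2 := Real.sq_sqrt hD.le
    obtain ⟨c, hc⟩ := hs.aeval_line hF v
    set t : ℂ := ⟨-B / A, D / A⟩ with ht
    have htim : t.im ≠ 0 := div_ne_zero hD0.ne' hA0
    have ht0 : t ≠ 0 := fun h => htim (by rw [h, Complex.zero_im])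
    have htQ : (C : ℂ) + 2 * B * t + A * t ^ 2 = 0 := by
      have hAt : (A : ℂ) * t = -B + D * Complex.I := by
        apply Complex.ext <;> simp [ht] <;> field_simp
      refine (mul_eq_zero.mp (?_ : (A : ℂ) * _ = 0)).resolve_left (by exact_mod_cast hA0)
      have hDsq' : (D : ℂ) ^ 2 = A * C - B ^ 2 := by exact_mod_cast hDsq
      linear_combination (A * t + B + D * Complex.I) * hAt + D ^ 2 * Complex.I_sq - hDsq'
    have heval := congrArg (Polynomial.aeval t) hc
    rw [comp_aeval_apply, ← eval_complexify, hQ] at heval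
    · simp only [map_add, map_mul, map_pow, Polynomial.aeval_C, Polynomial.aeval_X,
        Complex.coe_algebraMap] at heval
      have h1 : (c : ℂ) + (eval v F : ℝ) * t = 0 := by
        refine (mul_eq_zero.mp (?_ : t ^ 2 * _ = 0)).resolve_left (pow_ne_zero 2 ht0)
        linear_combination -heval
      have h2 := congrArg Complex.im h1
      simp only [Complex.add_im, Complex.ofReal_im, Complex.im_ofReal_mul, Complex.zero_im,
        zero_add] at h2
      exact (mul_eq_zero.mp h2).resolve_right htim
    · simp only [map_add, map_mul, Polynomial.aeval_C, Polynomial.aeval_X, Complex.coe_algebraMap]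
      rw [← htQ]
      simp only [hA, hB, hC]
      push_cast
      ring

/-! ### The space of real plane cubics -/

/-- The exponents of the ten monomials of degree three in three variables. -/
abbrev CubicExponent : Type := {e : Fin 3 →₀ ℕ // e ∈ Finset.finsuppAntidiag Finset.univ 3}

/-- The real cubic form with the given coefficients. -/
noncomputable def cubicForm (a : CubicExponent → ℝ) : MvPolynomial (Fin 3) ℝ :=
  ∑ e : CubicExponent, monomial e.1 (a e)

lemma isHomogeneous_cubicForm (a : CubicExponent → ℝ) : (cubicForm a).IsHomogeneous 3 := by
  refine IsHomogeneous.sum _ _ _ fun e _ => isHomogeneous_monomial _ ?_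
  rw [Finsupp.degree_eq_sum]
  exact (Finset.mem_finsuppAntidiag.mp e.2).1

lemma coeff_cubicForm (a : CubicExponent → ℝ) (e : CubicExponent) :
    coeff e.1 (cubicForm a) = a e := by
  classical
  rw [cubicForm, coeff_sum, Finset.sum_eq_single e]
  · rw [coeff_monomial, if_pos rfl]
  · intro e' _ he
    rw [coeff_monomial, if_neg fun h => he (Subtype.ext h)]
  · simp

lemma cubicForm_coeff {F : MvPolynomial (Fin 3) ℝ} (hF : F.IsHomogeneous 3) :
    cubicForm (fun e => coeff e.1 F) = F := by
  ext e
  by_cases he : e.degree = 3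
  · rw [Finsupp.degree_eq_sum] at he
    exact coeff_cubicForm _ ⟨e, Finset.mem_finsuppAntidiag.mpr ⟨he, Finset.subset_univ _⟩⟩
  · rw [(isHomogeneous_cubicForm _).coeff_eq_zero he, hF.coeff_eq_zero he]

lemma cubicForm_smul (c : ℝ) (a : CubicExponent → ℝ) : cubicForm (c • a) = C c * cubicForm a := by
  rw [cubicForm, cubicForm, Finset.mul_sum]
  exact Finset.sum_congr rfl fun e _ => by rw [C_mul_monomial, Pi.smul_apply, smul_eq_mul]

lemma continuous_aeval_cubicForm :
    Continuous fun x : (CubicExponent → ℝ) × (Fin 3 → ℂ) => aeval x.2 (cubicForm x.1) := by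
  simp only [cubicForm, map_sum, aeval_monomial, Finsupp.prod_fintype _ _ fun _ => pow_zero _,
    Complex.coe_algebraMap]
  fun_prop

lemma continuous_eval_pderiv_cubicForm (i : Fin 3) :
    Continuous fun x : (CubicExponent → ℝ) × (Fin 3 → ℝ) => eval x.2 (pderiv i (cubicForm x.1)) := by
  simp only [cubicForm, map_sum, pderiv_monomial, eval_monomial,
    Finsupp.prod_fintype _ _ fun _ => pow_zero _]
  fun_prop

/-- The quadruples of points (of the affine cone) through which there is a real cubic with a real
singular point. The coefficients and the singular point are normalized, so that they vary in a
compact space. -/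
def singularCubicLocus : Set (Fin 4 → Fin 3 → ℂ) :=
  {v | ∃ x : Metric.sphere (0 : CubicExponent → ℝ) 1 × Metric.sphere (0 : Fin 3 → ℝ) 1,
    (∀ i, aeval (v i) (cubicForm x.1) = 0) ∧ IsSingularAt (cubicForm x.1) x.2}

lemma isClosed_singularCubicLocus : IsClosed singularCubicLocus := by
  have h : IsClosed {y : (Fin 4 → Fin 3 → ℂ) ×
      (Metric.sphere (0 : CubicExponent → ℝ) 1 × Metric.sphere (0 : Fin 3 → ℝ) 1) |
      (∀ i, aeval (y.1 i) (cubicForm y.2.1) = 0) ∧ IsSingularAt (cubicForm y.2.1) y.2.2} := by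
    simp only [IsSingularAt, Set.ofPred_and, Set.ofPred_forall]
    refine IsClosed.inter (isClosed_iInter fun i => isClosed_eq ?_ continuous_const)
      (isClosed_iInter fun i => isClosed_eq ?_ continuous_const)
    · exact continuous_aeval_cubicForm.comp (f := fun y : (Fin 4 → Fin 3 → ℂ) ×
        (Metric.sphere (0 : CubicExponent → ℝ) 1 × Metric.sphere (0 : Fin 3 → ℝ) 1) =>
          (y.2.1.1, y.1 i)) (by fun_prop)
    · exact (continuous_eval_pderiv_cubicForm i).comp (f := fun y : (Fin 4 → Fin 3 → ℂ) ×
        (Metric.sphere (0 : CubicExponent → ℝ) 1 × Metric.sphere (0 : Fin 3 → ℝ) 1) =>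
          (y.2.1.1, y.2.2.1)) (by fun_prop)
  convert isClosedMap_fst_of_compactSpace _ h using 1
  ext v
  simp [singularCubicLocus]

lemma mem_singularCubicLocus {F : MvPolynomial (Fin 3) ℝ} (hF : F.IsHomogeneous 3) (hF0 : F ≠ 0)
    {v : Fin 4 → Fin 3 → ℂ} (hv : ∀ i, eval (v i) (complexify F) = 0) {s : Fin 3 → ℝ} (hs0 : s ≠ 0)
    (hs : IsSingularAt F s) : v ∈ singularCubicLocus := by
  set a : CubicExponent → ℝ := fun e => coeff e.1 F with ha
  have ha0 : a ≠ 0 := by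
    rintro h
    apply hF0
    rw [← cubicForm_coeff hF, ← ha, h]
    simp [cubicForm]
  refine ⟨⟨⟨‖a‖⁻¹ • a, ?_⟩, ⟨‖s‖⁻¹ • s, ?_⟩⟩, fun i => ?_, fun i => ?_⟩
  · rw [mem_sphere_zero_iff_norm, norm_smul, norm_inv, norm_norm, inv_mul_cancel₀]
    exact norm_ne_zero_iff.mpr ha0
  · rw [mem_sphere_zero_iff_norm, norm_smul, norm_inv, norm_norm, inv_mul_cancel₀]
    exact norm_ne_zero_iff.mpr hs0
  · rw [cubicForm_smul, cubicForm_coeff hF, map_mul, ← eval_complexify F, hv, mul_zero]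
  · rw [cubicForm_smul, cubicForm_coeff hF, pderiv_C_mul, map_mul, hs.smul hF, mul_zero]

lemma exists_of_mem_singularCubicLocus {v : Fin 4 → Fin 3 → ℂ} (hv : v ∈ singularCubicLocus) :
    ∃ F : MvPolynomial (Fin 3) ℝ, F.IsHomogeneous 3 ∧ F ≠ 0 ∧
      (∀ i, eval (v i) (complexify F) = 0) ∧ ∃ s, s ≠ 0 ∧ IsSingularAt F s := by
  obtain ⟨⟨⟨a, ha⟩, ⟨s, hs⟩⟩, hav, has⟩ := hv
  refine ⟨cubicForm a, isHomogeneous_cubicForm a, fun h => ?_, fun i => ?_, s, ?_, has⟩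
  · have : a = 0 := funext fun e => by rw [← coeff_cubicForm a e, h, coeff_zero, Pi.zero_apply]
    exact ne_zero_of_mem_unit_sphere ⟨a, ha⟩ this
  · rw [eval_complexify]
    exact hav i
  · exact ne_zero_of_mem_unit_sphere ⟨s, hs⟩

lemma mem_singularCubicLocus_of_smul {v w : Fin 4 → Fin 3 → ℂ}
    (h : ∀ i, ∃ c : ℂ, w i = c • v i) (hv : v ∈ singularCubicLocus) : w ∈ singularCubicLocus := by
  obtain ⟨F, hF, hF0, hFv, s, hs0, hs⟩ := exists_of_mem_singularCubicLocus hv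
  refine mem_singularCubicLocus hF hF0 (fun i => ?_) hs0 hs
  obtain ⟨c, hc⟩ := h i
  have hFc : (complexify F).IsHomogeneous 3 := hF.map _
  rw [hc, hFc.eval_smul, hFv, mul_zero]

/-! ### The topology of the projective plane -/

lemma CP2.isOpenQuotientMap_mk' :
    IsOpenQuotientMap (Projectivization.mk' ℂ (V := Fin 3 → ℂ) : _ → CP2) := by
  refine ⟨Quotient.mk''_surjective, continuous_coinduced_rng, fun S hS => ?_⟩
  rw [isOpen_coinduced]
  have h : Projectivization.mk' ℂ ⁻¹' (Projectivization.mk' ℂ '' S)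
      = ⋃ c : ℂˣ, (fun v : {v : Fin 3 → ℂ // v ≠ 0} =>
        (⟨c • v.1, (smul_ne_zero_iff_ne c).mpr v.2⟩ : {v : Fin 3 → ℂ // v ≠ 0})) ⁻¹' S := by
    ext v
    simp only [Set.mem_preimage, Set.mem_image, Set.mem_iUnion, Projectivization.mk'_eq_mk,
      Projectivization.mk_eq_mk_iff]
    constructor
    · rintro ⟨w, hw, c, hc⟩
      refine ⟨c, ?_⟩
      simp only [hc]
      exact hw
    · rintro ⟨c, hc⟩
      exact ⟨_, hc, c, rfl⟩
  rw [h]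
  refine isOpen_iUnion fun c => hS.preimage ?_
  exact (continuous_subtype_val.const_smul c).subtype_mk _

/-- Representatives of the points of a configuration together with their conjugates. -/
def withConj (v : Fin 4 → Fin 3 → ℂ) : Fin 4 ⊕ Fin 4 → Fin 3 → ℂ :=
  Sum.elim v fun i => star (v i)

lemma withConj_ne_zero {v : Fin 4 → Fin 3 → ℂ} (hv : ∀ i, v i ≠ 0) (x : Fin 4 ⊕ Fin 4) :
    withConj v x ≠ 0 := by
  rcases x with i | i
  · exact hv i
  · exact star_ne_zero.mpr (hv i)

lemma mk_eq_mk_iff_cross_eq_zero {v w : Fin 3 → ℂ} (hv : v ≠ 0) (hw : w ≠ 0) :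
    Projectivization.mk ℂ v hv = Projectivization.mk ℂ w hw ↔ crossProduct w v = 0 := by
  rw [Projectivization.mk_eq_mk_iff', ← not_iff_not, ← ne_eq (crossProduct w v),
    crossProduct_ne_zero_iff_linearIndependent, LinearIndependent.pair_iff' hw, not_exists]

lemma eightDistinctPoints_mk_iff {v : Fin 4 → Fin 3 → ℂ} (hv : ∀ i, v i ≠ 0) :
    EightDistinctPoints (fun i => Projectivization.mk ℂ (v i) (hv i)) ↔
      ∀ x y, x ≠ y → crossProduct (withConj v y) (withConj v x) ≠ 0 := by
  have h : (Sum.elim (fun i => Projectivization.mk ℂ (v i) (hv i))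
      fun i => CP2.conj (Projectivization.mk ℂ (v i) (hv i)))
      = fun x => Projectivization.mk ℂ (withConj v x) (withConj_ne_zero hv x) := by
    funext x
    rcases x with i | i
    · rfl
    · exact Projectivization.map_mk _
        (starLinearEquiv ℂ : (Fin 3 → ℂ) ≃ₗ⋆[ℂ] (Fin 3 → ℂ)).injective _ _
  rw [EightDistinctPoints, h]
  refine forall₂_congr fun x y => ?_
  rw [mk_eq_mk_iff_cross_eq_zero]
  exact not_imp_not.symm

lemma isOpen_setOf_withConj :
    IsOpen {v : Fin 4 → Fin 3 → ℂ |
      ∀ x y, x ≠ y → crossProduct (withConj v y) (withConj v x) ≠ 0} := by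
  have hc : ∀ (x : Fin 4 ⊕ Fin 4) (k : Fin 3),
      Continuous fun v : Fin 4 → Fin 3 → ℂ => withConj v x k := by
    rintro (i | i) k
    · exact continuous_apply_apply i k
    · exact (continuous_apply_apply i k).star
  simp only [Set.ofPred_forall]
  refine isOpen_iInter_of_finite fun x => isOpen_iInter_of_finite fun y =>
    isOpen_iInter_of_finite fun _ => isOpen_ne_fun ?_ continuous_const
  simp only [cross_apply]
  refine continuous_pi fun k => ?_
  have := hc x
  have := hc y
  fin_cases k <;> simp only [Fin.zero_eta, Fin.mk_one, Fin.reduceFinMk, Matrix.cons_val] <;> fun_prop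

/-! ### The open set of configurations -/

/-- The configurations of eight distinct points through which there is no real cubic with a real
singular point. -/
def goodConfigurations : Set (Fin 4 → CP2) :=
  {p | EightDistinctPoints p ∧ (fun i => (p i).rep) ∉ singularCubicLocus}

lemma isOpen_goodConfigurations : IsOpen goodConfigurations := by
  have hq := IsOpenQuotientMap.piMap fun _ : Fin 4 => CP2.isOpenQuotientMap_mk'
  rw [← hq.isQuotientMap.isOpen_preimage]
  have h : Pi.map (fun _ : Fin 4 => (Projectivization.mk' ℂ (V := Fin 3 → ℂ) : _ → CP2)) ⁻¹'
      goodConfigurations = (fun (v : Fin 4 → {v : Fin 3 → ℂ // v ≠ 0}) i => (v i).1) ⁻¹'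
        ({v | ∀ x y, x ≠ y → crossProduct (withConj v y) (withConj v x) ≠ 0}
          ∩ singularCubicLocusᶜ) := by
    ext v
    refine and_congr (eightDistinctPoints_mk_iff fun i => (v i).2) (not_congr ?_)
    have hrep := fun i => Projectivization.exists_smul_eq_mk_rep ℂ (v i).1 (v i).2
    constructor
    · refine mem_singularCubicLocus_of_smul fun i => ?_
      obtain ⟨c, hc⟩ := hrep i
      exact ⟨(c⁻¹ : ℂˣ), by rw [← Units.smul_def, eq_inv_smul_iff]; exact hc⟩
    · refine mem_singularCubicLocus_of_smul fun i => ?_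
      obtain ⟨c, hc⟩ := hrep i
      exact ⟨c, by rw [← Units.smul_def]; exact hc.symm⟩
  rw [h]
  refine (isOpen_setOf_withConj.inter isClosed_singularCubicLocus.isOpen_compl).preimage ?_
  exact continuous_pi fun i => continuous_subtype_val.comp (continuous_apply i)

lemma vanishesAt_emptyConic_iff (P : CP2) : VanishesAt (complexify emptyConic) P ↔
    P.rep 0 ^ 2 + P.rep 1 ^ 2 + P.rep 2 ^ 2 = 0 := by
  simp [VanishesAt, complexify, emptyConic]

/-- For points of the empty conic, a real cubic through them and their conjugates contains the
conic, and so it has no real singular point. -/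
lemma mem_goodConfigurations_of_conic {p : Fin 4 → CP2} (hp : EightDistinctPoints p)
    (hQ : ∀ i, VanishesAt (complexify emptyConic) (p i)) : p ∈ goodConfigurations := by
  refine ⟨hp, fun hbad => ?_⟩
  obtain ⟨F, hF, hF0, hFv, s, hs0, hs⟩ := exists_of_mem_singularCubicLocus hbad
  set v : Fin 4 → Fin 3 → ℂ := fun i => (p i).rep with hv
  have hv0 : ∀ i, v i ≠ 0 := fun i => (p i).rep_nonzero
  rw [show p = fun i => Projectivization.mk ℂ (v i) (hv0 i) from
    funext fun i => (p i).mk_rep.symm, eightDistinctPoints_mk_iff] at hp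
  have hvQ : ∀ i, v i 0 ^ 2 + v i 1 ^ 2 + v i 2 ^ 2 = 0 := fun i =>
    (vanishesAt_emptyConic_iff _).mp (hQ i)
  refine hF0 (eq_zero_of_conic_of_isSingularAt hF (fun q hq => ?_) hs0 hs)
  refine eval_eq_zero_of_conic (ι := Fin 4 ⊕ Fin 4) (v := withConj v) (by simp) (hF.map _)
    (fun x y c hxy => ?_) ?_ ?_ hq
  · by_contra hne
    refine hp x y hne ?_
    rw [hxy, map_smul, cross_self, smul_zero]
  · rintro (i | i)
    · exact hvQ i
    · have := congrArg star (hvQ i)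
      simpa [withConj] using this
  · rintro (i | i)
    · exact hFv i
    · have := congrArg star (hFv i)
      rw [← eval_star_complexify, star_zero] at this
      exact this

lemma goodConfigurations_nonempty : goodConfigurations.Nonempty := by
  set t : Fin 4 → ℝ := fun i => (i : ℝ) + 1 with ht
  have ht0 : ∀ i, 0 < t i := fun i => by positivity
  have htinj : ∀ i j, i ≠ j → t i - t j ≠ 0 := fun i j hij h => hij <| by
    simp only [ht, add_sub_add_right_eq_sub, sub_eq_zero] at h
    exact Fin.ext (by exact_mod_cast h)
  set v : Fin 4 → Fin 3 → ℂ := fun i => conicParam (t i) 1 with hv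
  have hv0 : ∀ i, v i ≠ 0 := fun i h => by
    have h2 := congrFun h 2
    simp only [hv, conicParam, Matrix.cons_val, Pi.zero_apply] at h2
    have := (ht0 i).ne'
    simp [this] at h2
  refine ⟨fun i => Projectivization.mk ℂ (v i) (hv0 i), mem_goodConfigurations_of_conic ?_ ?_⟩
  · rw [eightDistinctPoints_mk_iff]
    -- points of the same kind are separated by the second coordinate of the cross product,
    -- a point and a conjugate point by the first one
    have hsame : ∀ i j, i ≠ j → (2 * ((t i - t j) * (t i * t j + 1)) : ℂ) ≠ 0 := fun i j hij => by
      have := mul_pos (ht0 i) (ht0 j)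
      exact_mod_cast mul_ne_zero two_ne_zero (mul_ne_zero (htinj i j hij) (by positivity))
    have hdiff : ∀ i j, (2 * Complex.I * ((t i + t j) * (t i * t j + 1)) : ℂ) ≠ 0 := fun i j => by
      have h1 := mul_pos (ht0 i) (ht0 j)
      have h2 := add_pos (ht0 i) (ht0 j)
      refine mul_ne_zero (mul_ne_zero two_ne_zero Complex.I_ne_zero) ?_
      exact_mod_cast (mul_pos h2 (by positivity : 0 < t i * t j + 1)).ne'
    rintro (i | i) (j | j) hij h
    · refine hsame i j (by rintro rfl; exact hij rfl) ?_
      have := congrFun h 1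
      simp [withConj, hv, conicParam, cross_apply] at this
      linear_combination this
    · refine hdiff i j ?_
      have := congrFun h 0
      simp [withConj, hv, conicParam, cross_apply] at this
      linear_combination -this
    · refine hdiff i j ?_
      have := congrFun h 0
      simp [withConj, hv, conicParam, cross_apply] at this
      linear_combination this
    · refine hsame i j (by rintro rfl; exact hij rfl) ?_
      have := congrFun h 1
      simp [withConj, hv, conicParam, cross_apply] at this
      linear_combination this
  · intro i
    obtain ⟨c, hc⟩ := Projectivization.exists_smul_eq_mk_rep ℂ (v i) (hv0 i)
    rw [vanishesAt_emptyConic_iff, ← hc]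
    simp only [hv, conicParam, Pi.smul_apply, Units.smul_def, smul_eq_mul, Matrix.cons_val]
    linear_combination (c : ℂ) ^ 2 * ((t i : ℂ) ^ 2 + 1) ^ 2 * Complex.I_sq

theorem mainTheorem10 :
    ∃ U : Set (Fin 4 → CP2),
      IsOpen U ∧ U.Nonempty ∧
      (∀ p : Fin 4 → CP2, EightDistinctPoints p →
        (∀ i, VanishesAt (complexify emptyConic) (p i)) → p ∈ U) ∧
      ∀ p ∈ U, EightDistinctPoints p ∧
        ¬ ∃ F : MvPolynomial (Fin 3) ℝ, IsRationalPlaneCurve 3 (complexify F) ∧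
          ∀ i, VanishesAt (complexify F) (p i) ∧ VanishesAt (complexify F) (p i).conj := by
  refine ⟨goodConfigurations, isOpen_goodConfigurations, goodConfigurations_nonempty,
    fun p => mem_goodConfigurations_of_conic, fun p hp => ⟨hp.1, ?_⟩⟩
  rintro ⟨F, hF, hFp⟩
  obtain ⟨s, hs0, hs⟩ := hF.exists_real_isSingularAt
  have hF3 : F.IsHomogeneous 3 := IsHomogeneous.of_map (algebraMap ℝ ℂ).injective hF.1
  have hF0 : F ≠ 0 := fun h => hF.2.1.ne_zero (by rw [h, complexify, map_zero])
  exact hp.2 (mem_singularCubicLocus hF3 hF0 (fun i => (hFp i).1) hs0 hs)
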